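/- Let $0<\alpha<1$, $m>1$, $0<X<1$, $W>0$. For $0\le u\le z\le 1$ put $$K(z,u)=\frac{m+1}{m}\,\frac{1}{\Gamma(1-\alpha)}\int_{\left(\frac{1-z}{1-u}\right)^{\alpha/2}}^1\Big(s^{2/\alpha}(1-u)-\big(1-\tfrac{\alpha}{2}\big)(1-z)\Big)s^{2/\alpha}(1-s)^{-\alpha}\,ds ,$$ and let $y$ be the nontrivial solution of $y(z)^{m+1}=\int_0^z K(z,u)y(u)\,du$ on $[0,1]$ (continuous on $[0,1]$, positive on $(0,1]$). For $N\ge1$ let $h=1/N$, $z_n=n/N$. Given weights $w_{n,i}$ (which may depend on $N$) with $0<w_{n,i}\le W$ for $1\le i<n$, $z_n\le X$, let $$\delta_n(h)=\int_0^{z_n}K(z_n,t)y(t)\,dt-h\sum_{i=1}^{n-1}w_{n,i}K(z_n,z_i)y(z_i),\qquad \delta(h)=\max_{1\le n\le N}|\delta_n(h)|,$$ and let the nonnegative numbers $y_n$ be computed from a starting value $y_1$ by $$y_n^{m+1}=h\sum_{i=1}^{n-1}w_{n,i}K(z_n,z_i)\,y_i,\qquad n\ge2,\ z_n\le X .$$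 Put $e_n=y_n-y(nh)$. Let $0<C_1\le C_*$, where $$C_*^m=\begin{cases}\left(\frac{\alpha}{2}\right)^{1-\alpha}\dfrac{\Gamma\left(\frac{2-\alpha}{m}\right)}{\Gamma\left(2-\alpha+\frac{2-\alpha}{m}\right)}\,\dfrac{1}{2-\alpha+m(3-\alpha)}, & \alpha\le 1-\frac1{m+1},\\[3mm] \left(\frac{\alpha}{2}\right)^{2-\alpha}\dfrac{\Gamma\left(1+\frac{2-\alpha}{m}\right)}{\Gamma\left(2-\alpha+\frac{2-\alpha}{m}\right)}\,\dfrac{1}{2-\alpha}, & \alpha> 1-\frac1{m+1},\end{cases}$$ and set $$A=\frac{WD}{(m+1)C_1^m},\qquad D=\frac{m+1}{2m}\,\frac{1}{\Gamma(2-\alpha)}\left(\frac{1}{1-X}\right)^{1-\alpha}.$$ Assume that $\delta_n(h)\le0$ for all $n\ge2$ with $z_n\le X$, that $y_1\ge y(h)$, and that $$|e_1|\le\frac{1}{(m+1)C_1^m}\,\frac{\delta(h)}{h^{2-\alpha}} .$$ Then, as $h\to0^+$ with $nh\to z\in(0,X]$, $|e_n|\le \mathrm{const}\cdot\delta(h)\,h^{\alpha-A-1}$.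 More precisely, for every $z_0>0$ there is a constant $C>0$, depending only on $\alpha,m,X,W,C_1,z_0$, such that $|e_n|\le C\,\delta(h)\,h^{\alpha-A-1}$ for all such $N$, weights and starting values, and all $n$ with $z_0\le nh\le X$. -/

import Mathlib

noncomputable section

namespace PorousVolterra

/-- The kernel `K(z,u)`, `0 ≤ u ≤ z ≤ 1`, of the Volterra equation, for the fractional order `α`
and the nonlinearity exponent `m`. -/
def kernel (α m z u : ℝ) : ℝ :=
  (m + 1) / m * (1 / Real.Gamma (1 - α)) *
    ∫ s in (((1 - z) / (1 - u)) ^ (α / 2))..1,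
      (s ^ (2 / α) * (1 - u) - (1 - α / 2) * (1 - z)) * s ^ (2 / α) * (1 - s) ^ (-α)

/-- `y` is a nontrivial solution on `[0,1]` of `y(z)^(m+1) = ∫_0^z K(z,u) y(u) du`: it is
continuous, positive away from the origin, and satisfies the equation. -/
structure IsNontrivialSolution (α m : ℝ) (y : ℝ → ℝ) : Prop where
  continuousOn : ContinuousOn y (Set.Icc 0 1)
  pos : ∀ z ∈ Set.Ioc (0 : ℝ) 1, 0 < y z
  eq : ∀ z ∈ Set.Icc (0 : ℝ) 1, y z ^ (m + 1) = ∫ u in (0 : ℝ)..z, kernel α m z u * y u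

/-- The grid point `z_n = n / N`. -/
def grid (N n : ℕ) : ℝ := (n : ℝ) / (N : ℝ)

/-- The mesh size `h = 1 / N`. -/
def mesh (N : ℕ) : ℝ := 1 / (N : ℝ)

/-- The quadrature sum `h ∑_{i=1}^{n-1} w_{n,i} K(z_n, z_i) v_i`. -/
def quadrature (α m : ℝ) (N : ℕ) (w : ℕ → ℕ → ℝ) (v : ℕ → ℝ) (n : ℕ) : ℝ :=
  mesh N * ∑ i ∈ Finset.Ico 1 n, w n i * kernel α m (grid N n) (grid N i) * v i

/-- The local consistency error `δ_n(h)`. -/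
def localError (α m : ℝ) (y : ℝ → ℝ) (N : ℕ) (w : ℕ → ℕ → ℝ) (n : ℕ) : ℝ :=
  (∫ t in (0 : ℝ)..(grid N n), kernel α m (grid N n) t * y t) -
    quadrature α m N w (fun i => y (grid N i)) n

/-- The maximal consistency error `δ(h) = max_{1 ≤ n ≤ N} |δ_n(h)|`. -/
def maxError (α m : ℝ) (y : ℝ → ℝ) (N : ℕ) (hN : 1 ≤ N) (w : ℕ → ℕ → ℝ) : ℝ :=
  (Finset.Icc 1 N).sup' (Finset.nonempty_Icc.2 hN) fun n => |localError α m y N w n|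

/-- The numbers `Y_n`, `z_n ≤ X`, are produced by the scheme
`Y_n^(m+1) = h ∑_{i=1}^{n-1} w_{n,i} K(z_n, z_i) Y_i` for `n ≥ 2`, as nonnegative roots, from a
nonnegative starting value `Y_1`. -/
structure IsScheme (α m X : ℝ) (N : ℕ) (w : ℕ → ℕ → ℝ) (Y : ℕ → ℝ) : Prop where
  nonneg : ∀ n : ℕ, 1 ≤ n → grid N n ≤ X → 0 ≤ Y n
  step : ∀ n : ℕ, 2 ≤ n → grid N n ≤ X → Y n ^ (m + 1) = quadrature α m N w Y n

/-- The explicit constant of the lower power estimate `C₁ z^((2-α)/m) ≤ y(z)`. -/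
def lowerConst (α m : ℝ) : ℝ :=
  (if α ≤ 1 - 1 / (m + 1) then
    (α / 2) ^ (1 - α) *
      (Real.Gamma ((2 - α) / m) / Real.Gamma (2 - α + (2 - α) / m)) *
        (1 / (2 - α + m * (3 - α)))
  else
    (α / 2) ^ (2 - α) *
      (Real.Gamma (1 + (2 - α) / m) / Real.Gamma (2 - α + (2 - α) / m)) *
        (1 / (2 - α))) ^ (1 / m)

/-- The constant `D`. -/
def constD (α m X : ℝ) : ℝ :=
  (m + 1) / (2 * m) * (1 / Real.Gamma (2 - α)) * (1 / (1 - X)) ^ (1 - α)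

/-- The exponent `A = W D / ((m+1) C₁^m)`. -/
def constA (α m X W C₁ : ℝ) : ℝ :=
  W * constD α m X / ((m + 1) * C₁ ^ m)

end PorousVolterra

end

noncomputable section

namespace PorousVolterra

open MeasureTheory Set

/-! Write β = (2-α)/m, B for the Beta value B(β+1, 2-α), and d = `kernelCoeff α m`. Near the origin
K(z,u) is close to d (z-u)^(1-α), and comparison gives y(z) ≥ λ z^β there for λ^m slightly below d B
(`IsNontrivialSolution.power_le`). Since δ_n ≤ 0 and y_1 ≥ y(h), the errors stay nonnegative, and
convexity of x^(m+1) bounds (m+1) y(z_n)^m e_n by the quadrature of the errors plus δ(h)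
(`scheme_error`). Dividing by y^m ≥ λ^m z^(2-α) leaves e_n ≤ (A'/n) Σ_{i<n} e_i + O(δ h^(α-2)
n^(α-2)).

Near the origin A' can be taken close to W/((m+1)B), since d cancels. `lowerConst_rpow_lt` gives
C₁^m < D B, so that value lies strictly below A, and A' ≤ A on some (0, ε]. The exponent uses D and
C₁ only through this inequality, not through global bounds on K and y.

For z_n > ε one has 1/n < h/ε, so the constant occurring there only adds O(h) Σ e_i, which costs a
bounded exponential factor because nh ≤ 1. As Σ k^(α-2) converges, Gronwall (`gronwall_le`) gives
e_n = O(δ h^(α-2) n^(A-1)), and n = z_n/h turns this into the rate. -/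

/-! ### Two-sided power bounds for the kernel. -/

/-- The limit of `kernel α m z u / (z - u) ^ (1 - α)` at the origin. -/
def kernelCoeff (α m : ℝ) : ℝ :=
  (m + 1) / m * (1 / Real.Gamma (2 - α)) * (α / 2) ^ (2 - α)

/-- The factor of `(z - u) ^ (1 - α)` in the upper estimate of the kernel for `z ≤ Z`. -/
def kernelUpperCoeff (α m Z : ℝ) : ℝ :=
  (m + 1) / m * (1 / Real.Gamma (2 - α)) * ((α / 2 + Z) * (α / 2 / (1 - Z)) ^ (1 - α))

lemma kernelCoeff_pos {α m : ℝ} (hα0 : 0 < α) (hα1 : α < 1) (hm : 0 < m) :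
    0 < kernelCoeff α m := by
  have : 0 < Real.Gamma (2 - α) := Real.Gamma_pos_of_pos (by linarith)
  unfold kernelCoeff
  positivity

lemma kernelUpperCoeff_pos {α m Z : ℝ} (hα0 : 0 < α) (hα1 : α < 1) (hm : 0 < m)
    (hZ0 : 0 ≤ Z) (hZ1 : Z < 1) : 0 < kernelUpperCoeff α m Z := by
  have : 0 < Real.Gamma (2 - α) := Real.Gamma_pos_of_pos (by linarith)
  have : 0 < 1 - Z := by linarith
  unfold kernelUpperCoeff
  positivity

lemma intervalIntegrable_one_sub_rpow {r : ℝ} (hr : -1 < r) (c a b : ℝ) :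
    IntervalIntegrable (fun s : ℝ => (c - s) ^ r) volume a b := by
  have h := (intervalIntegral.intervalIntegrable_rpow' (a := c - a) (b := c - b) hr).comp_sub_left c
  simpa using h

lemma integral_one_sub_rpow_neg {α : ℝ} (hα1 : α < 1) (q : ℝ) :
    ∫ s in q..1, (1 - s) ^ (-α) = (1 - q) ^ (1 - α) / (1 - α) := by
  rw [intervalIntegral.integral_comp_sub_left (fun x : ℝ => x ^ (-α)) 1,
    integral_rpow (Or.inl (by linarith))]
  have : -α + 1 = 1 - α := by ring
  rw [this, sub_self, Real.zero_rpow (by linarith), sub_zero]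

lemma one_div_gamma_two_sub {α : ℝ} (hα1 : α < 1) :
    1 / Real.Gamma (2 - α) = 1 / Real.Gamma (1 - α) * (1 / (1 - α)) := by
  have h : (2 : ℝ) - α = (1 - α) + 1 := by ring
  have : 1 - α ≠ 0 := by linarith
  rw [h, Real.Gamma_add_one this]
  have : Real.Gamma (1 - α) ≠ 0 := (Real.Gamma_pos_of_pos (by linarith)).ne'
  field_simp

lemma intervalIntegrable_kernel_integrand {α : ℝ} (hα0 : 0 < α) (hα1 : α < 1) (z u q : ℝ) :
    IntervalIntegrable (fun s : ℝ =>
      (s ^ (2 / α) * (1 - u) - (1 - α / 2) * (1 - z)) * s ^ (2 / α) * (1 - s) ^ (-α))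
      volume q 1 := by
  refine (intervalIntegrable_one_sub_rpow (by linarith) 1 q 1).continuousOn_mul ?_
  have h : Continuous fun s : ℝ => s ^ (2 / α) := Real.continuous_rpow_const (by positivity)
  exact Continuous.continuousOn (by fun_prop)

/-- Bernoulli's estimates for the lower limit of the kernel integral. -/
lemma lowerLimit_bounds {a z u : ℝ} (ha0 : 0 < a) (ha1 : a ≤ 1) (hu : 0 ≤ u) (huz : u ≤ z)
    (hz : z < 1) :
    a * (z - u) ≤ 1 - ((1 - z) / (1 - u)) ^ a ∧
      1 - ((1 - z) / (1 - u)) ^ a ≤ a * (z - u) / (1 - z) := by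
  have h1 : 0 < 1 - z := by linarith
  have h2 : 0 < 1 - u := by linarith
  set r := (1 - z) / (1 - u) with hr
  have hr0 : 0 < r := by positivity
  have e1 : 1 - r = (z - u) / (1 - u) := by rw [hr]; field_simp; ring
  have e2 : 1 / r - 1 = (z - u) / (1 - z) := by rw [hr]; field_simp; ring
  constructor
  · have b := rpow_one_add_le_one_add_mul_self (s := r - 1) (by linarith) ha0.le ha1
    rw [add_sub_cancel] at b
    have : z - u ≤ (z - u) / (1 - u) := by
      rw [le_div_iff₀ h2]; nlinarith
    nlinarith
  · have hi : 0 < 1 / r := by positivity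
    have b := rpow_one_add_le_one_add_mul_self (s := 1 / r - 1) (by linarith) ha0.le ha1
    rw [add_sub_cancel, e2, one_div, Real.inv_rpow hr0.le] at b
    have hp : 0 < r ^ a := Real.rpow_pos_of_pos hr0 a
    -- Bernoulli at 1/r bounds (r^a)⁻¹; the inequality 2 - x ≤ 1/x turns this into a bound for 1 -
    -- r^a.
    have hx : 2 - r ^ a ≤ (r ^ a)⁻¹ := by
      rw [← one_div, le_div_iff₀ hp]
      nlinarith [sq_nonneg (r ^ a - 1)]
    rw [mul_div_assoc]
    linarith

lemma lowerLimit_mem {a z u : ℝ} (ha0 : 0 < a) (huz : u ≤ z) (hz : z < 1) :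
    0 ≤ ((1 - z) / (1 - u)) ^ a ∧ ((1 - z) / (1 - u)) ^ a ≤ 1 := by
  have h1 : 0 < 1 - z := by linarith
  have h2 : 0 < 1 - u := by linarith
  exact ⟨by positivity,
    Real.rpow_le_one (by positivity) ((div_le_one h2).2 (by linarith)) ha0.le⟩

/-- On the range of integration s^(2/α) (1-u) ≥ 1-z, so the first factor is at least (α/2)(1-z) and
s^(2/α) ≥ 1-Z. What remains is the integral of (1-s)^(-α), controlled by the distance of the lower
limit from 1. -/
lemma kernel_lower {α m z u Z : ℝ} (hα0 : 0 < α) (hα1 : α < 1) (hm : 0 < m)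
    (hu : 0 ≤ u) (huz : u ≤ z) (hzZ : z ≤ Z) (hZ : Z < 1) :
    kernelCoeff α m * (1 - Z) ^ 2 * (z - u) ^ (1 - α) ≤ kernel α m z u := by
  have hz : z < 1 := by linarith
  have h1 : 0 < 1 - z := by linarith
  have h2 : 0 < 1 - u := by linarith
  have ha : 0 < α / 2 := by linarith
  obtain ⟨b1, -⟩ := lowerLimit_bounds ha (by linarith : α / 2 ≤ 1) hu huz hz
  obtain ⟨q0, q1⟩ := lowerLimit_mem ha huz hz
  set q := ((1 - z) / (1 - u)) ^ (α / 2) with hq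
  have hΓ : 0 < Real.Gamma (1 - α) := Real.Gamma_pos_of_pos (by linarith)
  have key : ∫ s in q..1, (α / 2 * (1 - Z) * (1 - Z)) * (1 - s) ^ (-α) ≤
      ∫ s in q..1, (s ^ (2 / α) * (1 - u) - (1 - α / 2) * (1 - z)) * s ^ (2 / α) *
        (1 - s) ^ (-α) := by
    refine intervalIntegral.integral_mono_on q1
      ((intervalIntegrable_one_sub_rpow (by linarith) 1 q 1).const_mul _)
      (intervalIntegrable_kernel_integrand hα0 hα1 z u q) fun s hs => ?_
    have hs0 : 0 ≤ 1 - s := by linarith [hs.2]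
    have hsr : (1 - z) / (1 - u) ≤ s ^ (2 / α) := by
      calc (1 - z) / (1 - u) = q ^ (2 / α) := by
            rw [hq, ← Real.rpow_mul (by positivity)]
            have : α / 2 * (2 / α) = 1 := by field_simp
            rw [this, Real.rpow_one]
        _ ≤ s ^ (2 / α) := Real.rpow_le_rpow q0 hs.1 (by positivity)
    have hs1 : 1 - z ≤ s ^ (2 / α) * (1 - u) := by rwa [div_le_iff₀ h2] at hsr
    have hs2 : 1 - Z ≤ s ^ (2 / α) := by
      refine le_trans ?_ hsr
      rw [le_div_iff₀ h2]
      nlinarith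
    refine mul_le_mul_of_nonneg_right ?_ (Real.rpow_nonneg hs0 _)
    refine mul_le_mul ?_ hs2 (by linarith) ?_ <;> nlinarith
  rw [intervalIntegral.integral_const_mul, integral_one_sub_rpow_neg hα1] at key
  have hpow : (α / 2) ^ (1 - α) * (z - u) ^ (1 - α) ≤ (1 - q) ^ (1 - α) := by
    rw [← Real.mul_rpow ha.le (by linarith)]
    exact Real.rpow_le_rpow (mul_nonneg ha.le (by linarith)) b1 (by linarith)
  have hsplit : (α / 2) ^ (2 - α) = α / 2 * (α / 2) ^ (1 - α) := by
    rw [show (2 : ℝ) - α = 1 + (1 - α) by ring, Real.rpow_add ha, Real.rpow_one]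
  have hα1' : 0 < 1 - α := by linarith
  unfold kernel
  rw [← hq]
  calc kernelCoeff α m * (1 - Z) ^ 2 * (z - u) ^ (1 - α)
      = (m + 1) / m * (1 / Real.Gamma (1 - α)) * (α / 2 * (1 - Z) * (1 - Z) *
          (((α / 2) ^ (1 - α) * (z - u) ^ (1 - α)) / (1 - α))) := by
        rw [kernelCoeff, one_div_gamma_two_sub hα1, hsplit]; ring
    _ ≤ (m + 1) / m * (1 / Real.Gamma (1 - α)) * (α / 2 * (1 - Z) * (1 - Z) *
          ((1 - q) ^ (1 - α) / (1 - α))) := by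
        have : 0 ≤ 1 - Z := by linarith
        gcongr
    _ ≤ _ := by gcongr

lemma kernel_nonneg {α m z u : ℝ} (hα0 : 0 < α) (hα1 : α < 1) (hm : 0 < m)
    (hu : 0 ≤ u) (huz : u ≤ z) (hz : z < 1) : 0 ≤ kernel α m z u := by
  refine le_trans ?_ (kernel_lower hα0 hα1 hm hu huz le_rfl hz)
  have := kernelCoeff_pos hα0 hα1 hm
  have : 0 ≤ z - u := by linarith
  positivity

/-- The first factor is at most 1 - (1-α/2)(1-Z) ≤ α/2 + Z. As Z → 0 this coefficient and the one in
`kernel_lower` have the same limit, so d cancels in the exponent. -/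
lemma kernel_upper {α m z u Z : ℝ} (hα0 : 0 < α) (hα1 : α < 1) (hm : 0 < m)
    (hu : 0 ≤ u) (huz : u ≤ z) (hzZ : z ≤ Z) (hZ : Z < 1) :
    kernel α m z u ≤ kernelUpperCoeff α m Z * (z - u) ^ (1 - α) := by
  have hz : z < 1 := by linarith
  have h1 : 0 < 1 - z := by linarith
  have h2 : 0 < 1 - u := by linarith
  have hZ' : 0 < 1 - Z := by linarith
  have ha : 0 < α / 2 := by linarith
  obtain ⟨-, b2⟩ := lowerLimit_bounds ha (by linarith : α / 2 ≤ 1) hu huz hz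
  obtain ⟨q0, q1⟩ := lowerLimit_mem ha huz hz
  set q := ((1 - z) / (1 - u)) ^ (α / 2) with hq
  have hΓ : 0 < Real.Gamma (1 - α) := Real.Gamma_pos_of_pos (by linarith)
  have key : ∫ s in q..1, (s ^ (2 / α) * (1 - u) - (1 - α / 2) * (1 - z)) * s ^ (2 / α) *
        (1 - s) ^ (-α) ≤ ∫ s in q..1, (α / 2 + Z) * (1 - s) ^ (-α) := by
    refine intervalIntegral.integral_mono_on q1
      (intervalIntegrable_kernel_integrand hα0 hα1 z u q)
      ((intervalIntegrable_one_sub_rpow (by linarith) 1 q 1).const_mul _) fun s hs => ?_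
    have hs0 : 0 ≤ 1 - s := by linarith [hs.2]
    have hs1 : 0 ≤ s ^ (2 / α) := Real.rpow_nonneg (q0.trans hs.1) _
    have hs2 : s ^ (2 / α) ≤ 1 := Real.rpow_le_one (q0.trans hs.1) hs.2 (by positivity)
    refine mul_le_mul_of_nonneg_right ?_ (Real.rpow_nonneg hs0 _)
    have hx : s ^ (2 / α) * (1 - u) - (1 - α / 2) * (1 - z) ≤ α / 2 + Z := by nlinarith
    have hZ0 : 0 ≤ Z := by linarith
    calc _ ≤ (α / 2 + Z) * s ^ (2 / α) := mul_le_mul_of_nonneg_right hx hs1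
      _ ≤ α / 2 + Z := mul_le_of_le_one_right (by positivity) hs2
  rw [intervalIntegral.integral_const_mul, integral_one_sub_rpow_neg hα1] at key
  have hpow : (1 - q) ^ (1 - α) ≤ (α / 2 / (1 - Z)) ^ (1 - α) * (z - u) ^ (1 - α) := by
    rw [← Real.mul_rpow (by positivity) (by linarith)]
    refine Real.rpow_le_rpow (by linarith) (b2.trans ?_) (by linarith)
    rw [div_mul_eq_mul_div (α / 2) (1 - Z)]
    have : 0 ≤ z - u := by linarith
    gcongr
  have hα1' : 0 < 1 - α := by linarith
  have hZ0 : 0 ≤ Z := by linarith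
  unfold kernel
  rw [← hq]
  calc _ ≤ (m + 1) / m * (1 / Real.Gamma (1 - α)) * ((α / 2 + Z) *
          ((1 - q) ^ (1 - α) / (1 - α))) := mul_le_mul_of_nonneg_left key (by positivity)
    _ ≤ (m + 1) / m * (1 / Real.Gamma (1 - α)) * ((α / 2 + Z) *
          (((α / 2 / (1 - Z)) ^ (1 - α) * (z - u) ^ (1 - α)) / (1 - α))) := by gcongr
    _ = _ := by
        rw [kernelUpperCoeff, one_div_gamma_two_sub hα1]; ring

/-! ### Beta integrals of plain and shifted powers. -/

lemma integral_sub_rpow_mul_rpow {p β z : ℝ} (hp : -1 < p) (hβ : -1 < β) (hz : 0 < z) :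
    ∫ u in (0 : ℝ)..z, (z - u) ^ p * u ^ β =
      z ^ (1 + p + β) * ProbabilityTheory.beta (β + 1) (p + 1) := by
  have h := Complex.betaIntegral_scaled (β + 1 : ℝ) (p + 1 : ℝ) hz
  have hr : Complex.betaIntegral (β + 1 : ℝ) (p + 1 : ℝ) =
      ((ProbabilityTheory.beta (β + 1) (p + 1) : ℝ) : ℂ) := by
    rw [Complex.betaIntegral_eq_Gamma_mul_div _ _ (by simp; linarith) (by simp; linarith),
      ProbabilityTheory.beta, ← Complex.ofReal_add, Complex.Gamma_ofReal, Complex.Gamma_ofReal,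
      Complex.Gamma_ofReal]
    norm_cast
  rw [hr] at h
  have hl : ∫ x in (0 : ℝ)..z, (x : ℂ) ^ (((β + 1 : ℝ) : ℂ) - 1) *
      ((z : ℂ) - x) ^ (((p + 1 : ℝ) : ℂ) - 1) =
      ∫ x in (0 : ℝ)..z, (((z - x) ^ p * x ^ β : ℝ) : ℂ) := by
    refine intervalIntegral.integral_congr fun x hx => ?_
    rw [uIcc_of_le hz.le] at hx
    have e1 : ((β + 1 : ℝ) : ℂ) - 1 = (β : ℂ) := by push_cast; ring
    have e2 : ((p + 1 : ℝ) : ℂ) - 1 = (p : ℂ) := by push_cast; ring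
    rw [e1, e2, ← Complex.ofReal_sub, Complex.ofReal_mul, Complex.ofReal_cpow hx.1,
      Complex.ofReal_cpow (by linarith [hx.2]), mul_comm]
  rw [hl, intervalIntegral.integral_ofReal] at h
  have e3 : ((β + 1 : ℝ) : ℂ) + ((p + 1 : ℝ) : ℂ) - 1 = ((1 + p + β : ℝ) : ℂ) := by
    push_cast; ring
  rw [e3, ← Complex.ofReal_cpow hz.le] at h
  exact_mod_cast h

lemma integral_sub_rpow_mul_shifted_rpow {p β z τ : ℝ} (hp : -1 < p) (hβ : 0 < β)
    (hτ : 0 ≤ τ) (hz : τ < z) :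
    ∫ u in (0 : ℝ)..z, (z - u) ^ p * (max (u - τ) 0) ^ β =
      (z - τ) ^ (1 + p + β) * ProbabilityTheory.beta (β + 1) (p + 1) := by
  have hc : Continuous fun u : ℝ => (max (u - τ) 0) ^ β :=
    (Real.continuous_rpow_const hβ.le).comp (by fun_prop)
  have hi : ∀ a b, IntervalIntegrable (fun u => (z - u) ^ p * (max (u - τ) 0) ^ β) volume a b :=
    fun a b => (intervalIntegrable_one_sub_rpow hp z a b).mul_continuousOn hc.continuousOn
  rw [← intervalIntegral.integral_add_adjacent_intervals (hi 0 τ) (hi τ z)]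
  have h0 : ∫ u in (0 : ℝ)..τ, (z - u) ^ p * (max (u - τ) 0) ^ β = 0 := by
    rw [intervalIntegral.integral_congr (g := fun _ => (0 : ℝ))]
    · simp
    · intro u hu
      rw [uIcc_of_le hτ] at hu
      simp only
      rw [max_eq_right (by linarith [hu.2]), Real.zero_rpow hβ.ne', mul_zero]
  rw [h0, zero_add, ← integral_sub_rpow_mul_rpow hp (by linarith) (sub_pos.2 hz)]
  have := intervalIntegral.integral_comp_sub_right (a := τ) (b := z)
    (fun x => (z - τ - x) ^ p * x ^ β) τ
  rw [sub_self] at this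
  rw [← this]
  refine intervalIntegral.integral_congr fun u hu => ?_
  rw [uIcc_of_le hz.le] at hu
  rw [max_eq_left (by linarith [hu.1])]
  congr 2
  ring

/-! ### Lower power estimate for the solution. -/

lemma IsNontrivialSolution.nonneg {α m : ℝ} {y : ℝ → ℝ} (hy : IsNontrivialSolution α m y)
    {z : ℝ} (hz : z ∈ Icc (0 : ℝ) 1) : 0 ≤ y z := by
  have h : Icc (0 : ℝ) 1 ⊆ closure (Ioc 0 1) := by rw [closure_Ioc zero_ne_one]
  have hc : ContinuousWithinAt y (Ioc 0 1) z := (hy.continuousOn z hz).mono Ioc_subset_Icc_self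
  have : (nhdsWithin z (Ioc 0 1)).NeBot := mem_closure_iff_nhdsWithin_neBot.1 (h hz)
  refine ge_of_tendsto hc ?_
  filter_upwards [self_mem_nhdsWithin] with x hx using (hy.pos x hx).le

/-- A non-integrable function has integral 0 by convention, whereas this integral equals y(z)^(m+1)
> 0. -/
lemma IsNontrivialSolution.intervalIntegrable {α m : ℝ} {y : ℝ → ℝ}
    (hy : IsNontrivialSolution α m y) {z : ℝ} (hz : z ∈ Ioc (0 : ℝ) 1) :
    IntervalIntegrable (fun u => kernel α m z u * y u) volume 0 z := by
  apply intervalIntegral.intervalIntegrable_of_integral_ne_zero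
  rw [← hy.eq z (Ioc_subset_Icc_self hz)]
  exact (Real.rpow_pos_of_pos (hy.pos z hz) _).ne'

/-- Comparison with the translated subsolutions `lam (z - τ)_+ ^ β`. -/
lemma IsNontrivialSolution.shifted_power_lt {α m d lam Z τ β : ℝ} {y : ℝ → ℝ}
    (hy : IsNontrivialSolution α m y) (hα1 : α < 1) (hm : 0 < m) (hd : 0 ≤ d)
    (hβ0 : 0 < β) (hβ : β * m = 2 - α)
    (hlam : 0 < lam) (hlam' : lam ^ m < d * ProbabilityTheory.beta (β + 1) (2 - α))
    (hZ : Z < 1) (hK : ∀ z u, 0 ≤ u → u ≤ z → z ≤ Z → d * (z - u) ^ (1 - α) ≤ kernel α m z u)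
    (hτ : 0 < τ) {z : ℝ} (hz : τ ≤ z) (hzZ : z ≤ Z) :
    lam * (z - τ) ^ β < y z := by
  by_contra! hcon
  set φ : ℝ → ℝ := fun u => lam * (max (u - τ) 0) ^ β with hφ
  have hφc : Continuous φ :=
    continuous_const.mul ((Real.continuous_rpow_const hβ0.le).comp (by fun_prop))
  set S := {u ∈ Icc τ Z | y u ≤ φ u} with hS
  have hyc : ContinuousOn y (Icc τ Z) := hy.continuousOn.mono (Icc_subset_Icc hτ.le hZ.le)
  have hScl : IsClosed S := isClosed_Icc.isClosed_le hyc hφc.continuousOn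
  have hScpt : IsCompact S := isCompact_Icc.of_isClosed_subset hScl fun u hu => hu.1
  have hSne : S.Nonempty := ⟨z, ⟨hz, hzZ⟩, by simpa [hφ, max_eq_left (sub_nonneg.2 hz)] using hcon⟩
  -- The first contact point. At τ the barrier vanishes while y is positive, so t > τ; without the
  -- shift the two could touch at the origin.
  obtain ⟨t, htS, htmin⟩ := hScpt.exists_isLeast hSne
  have ht0 : 0 < t := hτ.trans_le htS.1.1
  have ht1 : t ∈ Ioc (0 : ℝ) 1 := ⟨ht0, htS.1.2.trans hZ.le⟩
  have hyt := hy.pos t ht1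
  have htτ : τ < t := by
    rcases htS.1.1.eq_or_lt with h | h
    · exfalso
      have := htS.2
      rw [← h] at this hyt
      simp [hφ, Real.zero_rpow hβ0.ne'] at this
      linarith
    · exact h
  have hle : ∀ u ∈ Ioo 0 t, φ u ≤ y u := by
    intro u hu
    rcases le_or_gt u τ with h | h
    · have : φ u = 0 := by
        simp only [hφ]
        rw [max_eq_right (by linarith), Real.zero_rpow hβ0.ne', mul_zero]
      rw [this]
      exact hy.nonneg ⟨hu.1.le, hu.2.le.trans ht1.2⟩
    · by_contra! hh
      exact absurd (htmin ⟨⟨h.le, hu.2.le.trans htS.1.2⟩, hh.le⟩) (not_le.2 hu.2)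
  have hint : IntervalIntegrable (fun u => d * (t - u) ^ (1 - α) * φ u) volume 0 t :=
    ((intervalIntegrable_one_sub_rpow (by linarith) t 0 t).const_mul d).mul_continuousOn
      hφc.continuousOn
  have hmono : ∫ u in (0 : ℝ)..t, d * (t - u) ^ (1 - α) * φ u ≤
      ∫ u in (0 : ℝ)..t, kernel α m t u * y u := by
    refine intervalIntegral.integral_mono_on_of_le_Ioo ht0.le hint (hy.intervalIntegrable ht1)
      fun u hu => ?_
    have hφ0 : 0 ≤ φ u := by simp only [hφ]; positivity
    have htu : 0 ≤ t - u := by linarith [hu.2]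
    have hk := hK t u hu.1.le hu.2.le htS.1.2
    exact mul_le_mul hk (hle u hu) hφ0 (le_trans (by positivity) hk)
  rw [← hy.eq t (Ioc_subset_Icc_self ht1)] at hmono
  have hval : ∫ u in (0 : ℝ)..t, d * (t - u) ^ (1 - α) * φ u =
      d * lam * ((t - τ) ^ (1 + (1 - α) + β) * ProbabilityTheory.beta (β + 1) (2 - α)) := by
    have := integral_sub_rpow_mul_shifted_rpow (p := 1 - α) (by linarith) hβ0 hτ.le htτ
    rw [show (1 : ℝ) - α + 1 = 2 - α by ring] at this
    rw [← this, ← intervalIntegral.integral_const_mul]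
    refine intervalIntegral.integral_congr fun u _ => ?_
    simp only [hφ]
    ring
  rw [hval] at hmono
  have hs : 0 < t - τ := by linarith
  have hup : y t ^ (m + 1) ≤ lam ^ m * lam * (t - τ) ^ (1 + (1 - α) + β) := by
    calc y t ^ (m + 1) ≤ (lam * (t - τ) ^ β) ^ (m + 1) := by
          refine Real.rpow_le_rpow hyt.le ?_ (by linarith)
          simpa [hφ, max_eq_left hs.le] using htS.2
      _ = lam ^ m * lam * (t - τ) ^ (1 + (1 - α) + β) := by
          rw [Real.mul_rpow hlam.le (by positivity), ← Real.rpow_mul hs.le,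
            Real.rpow_add hlam, Real.rpow_one]
          congr 2
          linarith
  -- With s = t-τ and β(m+1) = 2-α+β, the bounds read d λ B s^(2-α+β) ≤ y(t)^(m+1) ≤ λ^(m+1)
  -- s^(2-α+β), against λ^m < d B.
  have hpos : 0 < lam * (t - τ) ^ (1 + (1 - α) + β) := by positivity
  have := mul_lt_mul_of_pos_right hlam' hpos
  nlinarith

/-- A lower power estimate for the nontrivial solutions. -/
lemma IsNontrivialSolution.power_le {α m d lam Z β : ℝ} {y : ℝ → ℝ}
    (hy : IsNontrivialSolution α m y) (hα1 : α < 1) (hm : 0 < m) (hd : 0 ≤ d)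
    (hβ0 : 0 < β) (hβ : β * m = 2 - α)
    (hlam : 0 < lam) (hlam' : lam ^ m < d * ProbabilityTheory.beta (β + 1) (2 - α))
    (hZ : Z < 1) (hK : ∀ z u, 0 ≤ u → u ≤ z → z ≤ Z → d * (z - u) ^ (1 - α) ≤ kernel α m z u)
    {z : ℝ} (hz : 0 < z) (hzZ : z ≤ Z) :
    lam * z ^ β ≤ y z := by
  have hc : Continuous fun τ : ℝ => lam * (z - τ) ^ β :=
    continuous_const.mul ((Real.continuous_rpow_const hβ0.le).comp (by fun_prop))
  have ht : Filter.Tendsto (fun τ : ℝ => lam * (z - τ) ^ β) (nhdsWithin 0 (Ioi 0))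
      (nhds (lam * z ^ β)) := by
    have := hc.tendsto 0
    rw [sub_zero] at this
    exact this.mono_left nhdsWithin_le_nhds
  refine le_of_tendsto ht ?_
  filter_upwards [Ioc_mem_nhdsGT hz] with τ hτ
  exact (hy.shifted_power_lt hα1 hm hd hβ0 hβ hlam hlam' hZ hK hτ.1 hτ.2 hzZ).le

/-! ### Discrete Gronwall inequality. -/

/-- A discrete Gronwall inequality for a Cesàro-type recurrence with a summable forcing. -/
lemma gronwall_sum_le {A κ p b : ℝ} (hA : 0 ≤ A) (hκ : 0 ≤ κ) (hb : 0 ≤ b) (e : ℕ → ℝ) (L : ℕ)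
    (he1 : e 1 ≤ b)
    (he : ∀ n, 2 ≤ n → n ≤ L →
      e n ≤ (A / n + κ) * ∑ i ∈ Finset.Ico 1 n, e i + b * (n : ℝ) ^ (-p)) :
    ∀ n, 1 ≤ n → n ≤ L → ∑ i ∈ Finset.Ico 1 (n + 1), e i ≤
      b * ((n : ℝ) ^ A * Real.exp (κ * n)) * ∑ k ∈ Finset.Ico 1 (n + 1), (k : ℝ) ^ (-p) := by
  intro n hn
  induction n, hn using Nat.le_induction with
  | base =>
    intro _
    have : 1 ≤ Real.exp κ := Real.one_le_exp hκ
    simp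
    nlinarith
  | succ n hn ih =>
    intro hL
    have ih := ih (by omega)
    have hn0 : (0 : ℝ) < n := by exact_mod_cast hn
    rw [Finset.sum_Ico_succ_top (by omega : 1 ≤ n + 1),
      Finset.sum_Ico_succ_top (by omega : 1 ≤ n + 1)]
    have h := he (n + 1) (by omega) hL
    set S := ∑ i ∈ Finset.Ico 1 (n + 1), e i
    set T := ∑ k ∈ Finset.Ico 1 (n + 1), (k : ℝ) ^ (-p)
    have hT : 0 ≤ T := Finset.sum_nonneg fun k _ => by positivity
    push_cast at h ⊢
    set x : ℝ := (n : ℝ) + 1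
    have hx1 : 1 ≤ x := by simp [x]
    have hx0 : 0 < x := by linarith
    -- One step of the recurrence is absorbed by n^A e^(κn), because 1/x ≤ log(x/n) for x = n+1.
    have hgrow : (1 + A / x + κ) * ((n : ℝ) ^ A * Real.exp (κ * n)) ≤
        x ^ A * Real.exp (κ * x) := by
      have h1 : 1 + A / x ≤ (x / n) ^ A := by
        have hl : 1 / x ≤ Real.log (x / n) := by
          have := Real.one_sub_inv_le_log_of_pos (x := x / n) (by positivity)
          have e : 1 - (x / n)⁻¹ = 1 / x := by
            rw [inv_div]; field_simp; simp [x]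
          rwa [e] at this
        rw [Real.rpow_def_of_pos (by positivity)]
        calc 1 + A / x ≤ Real.exp (A / x) := by linarith [Real.add_one_le_exp (A / x)]
          _ ≤ _ := Real.exp_le_exp.2 (by
            rw [div_eq_mul_one_div, mul_comm (Real.log _)]; gcongr)
      have h2 : 1 + κ ≤ Real.exp κ := by linarith [Real.add_one_le_exp κ]
      calc (1 + A / x + κ) * ((n : ℝ) ^ A * Real.exp (κ * n))
          ≤ ((1 + A / x) * (1 + κ)) * ((n : ℝ) ^ A * Real.exp (κ * n)) := by
            gcongr
            have : 0 ≤ A / x * κ := by positivity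
            linarith
        _ ≤ ((x / n) ^ A * Real.exp κ) * ((n : ℝ) ^ A * Real.exp (κ * n)) := by
            gcongr
        _ = x ^ A * Real.exp (κ * x) := by
            rw [Real.div_rpow hx0.le hn0.le]
            have : Real.exp (κ * x) = Real.exp κ * Real.exp (κ * n) := by
              rw [← Real.exp_add]; congr 1; simp only [x]; ring
            rw [this]
            field_simp
    have hone : 1 ≤ x ^ A * Real.exp (κ * x) := by
      have h1 : 1 ≤ x ^ A := Real.one_le_rpow hx1 hA
      have h2 : 1 ≤ Real.exp (κ * x) := Real.one_le_exp (by positivity)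
      nlinarith
    have hp0 : 0 ≤ x ^ (-p) := by positivity
    calc S + e (n + 1) ≤ (1 + A / x + κ) * S + b * x ^ (-p) := by linarith
      _ ≤ (1 + A / x + κ) * (b * ((n : ℝ) ^ A * Real.exp (κ * n)) * T) + b * x ^ (-p) := by
          gcongr
      _ = b * T * ((1 + A / x + κ) * ((n : ℝ) ^ A * Real.exp (κ * n))) + b * x ^ (-p) := by ring
      _ ≤ b * T * (x ^ A * Real.exp (κ * x)) + b * x ^ (-p) * (x ^ A * Real.exp (κ * x)) := by
          refine add_le_add (mul_le_mul_of_nonneg_left hgrow (by positivity)) ?_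
          exact le_mul_of_one_le_right (by positivity) hone
      _ = _ := by ring

/-- The pointwise form of the discrete Gronwall inequality, with `κ = c h` and `n h ≤ 1`. -/
lemma gronwall_le {A c p : ℝ} (hA : 0 ≤ A) (hc : 0 ≤ c) (hp : 1 < p) :
    ∃ Q : ℝ, 0 < Q ∧ ∀ (h b : ℝ) (e : ℕ → ℝ) (L : ℕ), 0 ≤ h → 0 ≤ b → L * h ≤ 1 →
      (∀ n, 1 ≤ n → n ≤ L → 0 ≤ e n) → e 1 ≤ b →
      (∀ n : ℕ, 2 ≤ n → n ≤ L →
        e n ≤ (A / n + c * h) * ∑ i ∈ Finset.Ico 1 n, e i + b * (n : ℝ) ^ (-p)) →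
      ∀ n : ℕ, 1 ≤ n → n ≤ L → e n ≤ Q * b * (n : ℝ) ^ (A - 1) := by
  have hsum : Summable fun k : ℕ => (k : ℝ) ^ (-p) := Real.summable_nat_rpow.2 (by linarith)
  set σ := ∑' k : ℕ, (k : ℝ) ^ (-p)
  have hσ0 : 0 ≤ σ := tsum_nonneg fun k => by positivity
  -- The first summand comes from the partial sums, with h ≤ 1/n; the 1 absorbs the forcing, as
  -- n^(-p) ≤ n^(A-1), and the case n = 1.
  refine ⟨(A + c) * (Real.exp c * σ) + 1, by positivity, ?_⟩
  intro h b e L hh hb hLh he0 he1 he n hn hnL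
  rcases hn.eq_or_lt with rfl | hn2
  · simp
    have : 0 ≤ (A + c) * (Real.exp c * σ) * b := by positivity
    linarith
  obtain ⟨k, rfl⟩ : ∃ k, n = k + 1 := ⟨n - 1, by omega⟩
  have hS := gronwall_sum_le hA (mul_nonneg hc hh) hb e L he1 he k (by omega) (by omega)
  have hn' := he (k + 1) hn2 hnL
  set S := ∑ i ∈ Finset.Ico 1 (k + 1), e i
  have hT : ∑ k ∈ Finset.Ico 1 (k + 1), (k : ℝ) ^ (-p) ≤ σ :=
    hsum.sum_le_tsum _ fun k _ => by positivity
  set x : ℝ := ((k + 1 : ℕ) : ℝ) with hx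
  have hkx : (k : ℝ) ≤ x := by rw [hx]; push_cast; linarith
  have hx1 : 1 ≤ x := by rw [hx]; push_cast; linarith [Nat.cast_nonneg (α := ℝ) k]
  have hx0 : 0 < x := by linarith
  have hxL : x ≤ L := by rw [hx]; exact_mod_cast hnL
  have hxh : x * h ≤ 1 := le_trans (by gcongr) hLh
  have hS0 : 0 ≤ S := Finset.sum_nonneg fun i hi => by
    rw [Finset.mem_Ico] at hi
    exact he0 i hi.1 (by omega)
  have hS1 : S ≤ b * (x ^ A * Real.exp c) * σ := by
    refine hS.trans ?_
    have : c * h * k ≤ c := by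
      have : h * k ≤ 1 := le_trans (by rw [mul_comm]; gcongr) hxh
      nlinarith
    gcongr
  have hco : A / x + c * h ≤ (A + c) / x := by
    rw [add_div]
    have : h ≤ 1 / x := by rw [le_div_iff₀ hx0]; linarith
    have : c * h ≤ c * (1 / x) := by gcongr
    rw [mul_one_div] at this
    linarith
  have hpw : x ^ (-p) ≤ x ^ (A - 1) := Real.rpow_le_rpow_of_exponent_le hx1 (by linarith)
  have hxA : x ^ (A - 1) = x ^ A / x := by rw [Real.rpow_sub hx0, Real.rpow_one]
  calc e (k + 1) ≤ (A / x + c * h) * S + b * x ^ (-p) := hn'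
    _ ≤ (A + c) / x * (b * (x ^ A * Real.exp c) * σ) + b * x ^ (A - 1) := by gcongr
    _ = _ := by rw [hxA]; field_simp

/-! ### Comparison of the explicit constants. -/

lemma rpow_exponent_pos {α m : ℝ} (hα1 : α < 1) (hm : 0 < m) : 0 < (2 - α) / m :=
  div_pos (by linarith) hm

lemma constD_mul_beta {α m : ℝ} (hα1 : α < 1) (hm : 0 < m) (X : ℝ) :
    constD α m X * ProbabilityTheory.beta ((2 - α) / m + 1) (2 - α) =
      (1 / (1 - X)) ^ (1 - α) *
        (Real.Gamma (1 + (2 - α) / m) / Real.Gamma (2 - α + (2 - α) / m) * (1 / (2 * (2 - α)))) := by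
  have hβ := rpow_exponent_pos hα1 hm
  have h2 : 0 < 2 - α := by linarith
  have hs : (2 - α) / m + 1 + (2 - α) = (2 - α + (2 - α) / m) + 1 := by ring
  have hne : 2 - α + (2 - α) / m ≠ 0 := by positivity
  have g1 : Real.Gamma (2 - α) ≠ 0 := (Real.Gamma_pos_of_pos h2).ne'
  have g2 : Real.Gamma (2 - α + (2 - α) / m) ≠ 0 := (Real.Gamma_pos_of_pos (by positivity)).ne'
  have hv : 2 - α + (2 - α) / m = (2 - α) * (m + 1) / m := by field_simp
  rw [ProbabilityTheory.beta, constD, hs, Real.Gamma_add_one hne, add_comm ((2 - α) / m) 1]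
  set P := Real.Gamma (2 - α + (2 - α) / m)
  set R := Real.Gamma (1 + (2 - α) / m)
  rw [hv]
  field_simp

/-- Strictness comes from X > 0, which makes (1/(1-X))^(1-α) > 1. The rest is Γ(1+β) = β Γ(β) with
m(3-α) ≥ 2m in the first branch, and (α/2)^(2-α) ≤ 1/2 in the second. -/
lemma lowerConst_rpow_lt {α m X : ℝ} (hα0 : 0 < α) (hα1 : α < 1) (hm : 0 < m)
    (hX0 : 0 < X) (hX1 : X < 1) :
    lowerConst α m ^ m < constD α m X * ProbabilityTheory.beta ((2 - α) / m + 1) (2 - α) := by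
  have hβ := rpow_exponent_pos hα1 hm
  have h2 : 0 < 2 - α := by linarith
  have h3 : 0 < 3 - α := by linarith
  have ha : 0 < α / 2 := by linarith
  have g1 : 0 < Real.Gamma ((2 - α) / m) := Real.Gamma_pos_of_pos hβ
  have g2 : 0 < Real.Gamma (2 - α + (2 - α) / m) := Real.Gamma_pos_of_pos (by positivity)
  have g3 : 0 < Real.Gamma (1 + (2 - α) / m) := Real.Gamma_pos_of_pos (by positivity)
  rw [constD_mul_beta hα1 hm]
  set P := Real.Gamma (2 - α + (2 - α) / m) with hP
  set R := Real.Gamma (1 + (2 - α) / m) with hR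
  have hRβ : R = (2 - α) / m * Real.Gamma ((2 - α) / m) := by
    rw [hR, add_comm, Real.Gamma_add_one hβ.ne']
  have hX : 1 < (1 / (1 - X)) ^ (1 - α) := by
    refine Real.one_lt_rpow ?_ (by linarith)
    rw [lt_div_iff₀ (by linarith)]
    linarith
  have hpos : 0 < R / P * (1 / (2 * (2 - α))) := by positivity
  refine lt_of_le_of_lt ?_ (lt_mul_of_one_lt_left hpos hX)
  unfold lowerConst
  split_ifs with hc
  · rw [← Real.rpow_mul (by positivity), one_div_mul_cancel hm.ne', Real.rpow_one]
    have hA : (α / 2) ^ (1 - α) ≤ 1 := Real.rpow_le_one ha.le (by linarith) (by linarith)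
    have hB : 1 / (2 - α + m * (3 - α)) ≤ 1 / (2 * m) :=
      one_div_le_one_div_of_le (by positivity) (by nlinarith)
    calc _ ≤ 1 * (Real.Gamma ((2 - α) / m) / P) * (1 / (2 * m)) := by gcongr
      _ = _ := by rw [hRβ]; field_simp
  · rw [← Real.rpow_mul (by positivity), one_div_mul_cancel hm.ne', Real.rpow_one]
    have hA : (α / 2) ^ (2 - α) ≤ 1 / 2 := by
      calc (α / 2) ^ (2 - α) ≤ (α / 2) ^ (1 : ℝ) :=
            Real.rpow_le_rpow_of_exponent_ge ha (by linarith) (by linarith)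
        _ ≤ 1 / 2 := by rw [Real.rpow_one]; linarith
    calc _ ≤ 1 / 2 * (R / P) * (1 / (2 - α)) := by gcongr
      _ = _ := by field_simp

lemma kernelUpperCoeff_zero {α m : ℝ} (hα0 : 0 < α) :
    kernelUpperCoeff α m 0 = kernelCoeff α m := by
  have ha : 0 < α / 2 := by linarith
  rw [kernelUpperCoeff, kernelCoeff, show (2 : ℝ) - α = 1 + (1 - α) by ring, Real.rpow_add ha,
    Real.rpow_one]
  simp

lemma exists_rpow_eq {m c : ℝ} (hm : 0 < m) (hc : 0 < c) : ∃ x : ℝ, 0 < x ∧ x ^ m = c :=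
  ⟨c ^ (1 / m), by positivity, by
    rw [← Real.rpow_mul hc.le, one_div_mul_cancel hm.ne', Real.rpow_one]⟩

/-- Near the origin the kernel and the solution are controlled well enough for the exponent
`constA`. -/
lemma exists_local_constants {α m X W C₁ : ℝ} (hα0 : 0 < α) (hα1 : α < 1) (hm : 0 < m)
    (hX0 : 0 < X) (hX1 : X < 1) (hW : 0 < W) (hC0 : 0 < C₁) (hC1 : C₁ ≤ lowerConst α m) :
    ∃ ε lam : ℝ, 0 < ε ∧ ε < 1 ∧ 0 < lam ∧
      lam ^ m < kernelCoeff α m * (1 - ε) ^ 2 *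
        ProbabilityTheory.beta ((2 - α) / m + 1) (2 - α) ∧
      W * kernelUpperCoeff α m ε / ((m + 1) * lam ^ m) ≤ constA α m X W C₁ := by
  have hβ := rpow_exponent_pos hα1 hm
  have h2 : 0 < 2 - α := by linarith
  have hB : 0 < ProbabilityTheory.beta ((2 - α) / m + 1) (2 - α) :=
    ProbabilityTheory.beta_pos (by linarith) h2
  have hlt := lowerConst_rpow_lt hα0 hα1 hm hX0 hX1
  set B := ProbabilityTheory.beta ((2 - α) / m + 1) (2 - α)
  have hD0 := kernelCoeff_pos hα0 hα1 hm
  have hC : C₁ ^ m < constD α m X * B :=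
    (Real.rpow_le_rpow hC0.le hC1 hm.le).trans_lt hlt
  have hCm : 0 < C₁ ^ m := by positivity
  -- The ratio of the upper kernel coefficient to λ^m = d(1-ε)^3 B; it equals 1/B at ε = 0. The
  -- cube, against the square in `kernel_lower`, keeps λ^m strictly admissible.
  have hcont : ContinuousAt
      (fun ε : ℝ => kernelUpperCoeff α m ε / (kernelCoeff α m * (1 - ε) ^ 3 * B)) 0 := by
    unfold kernelUpperCoeff
    refine ContinuousAt.div ?_ (by fun_prop) (by simp; exact ⟨hD0.ne', hB.ne'⟩)
    refine continuousAt_const.mul (ContinuousAt.mul (by fun_prop) ?_)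
    refine ContinuousAt.rpow_const (ContinuousAt.div (by fun_prop) (by fun_prop) (by norm_num)) ?_
    right; linarith
  have hval : kernelUpperCoeff α m 0 / (kernelCoeff α m * (1 - 0) ^ 3 * B) <
      constD α m X / C₁ ^ m := by
    rw [kernelUpperCoeff_zero hα0, div_lt_div_iff₀ (by simp; positivity) hCm]
    have := mul_lt_mul_of_pos_left hC hD0
    simp
    linarith
  have hev := (hcont.eventually_lt continuousAt_const hval).filter_mono
    (nhdsWithin_le_nhds (s := Ioi 0))
  obtain ⟨ε, hε, hε0, hε1⟩ := (hev.and (Ioo_mem_nhdsGT (zero_lt_one (α := ℝ)))).exists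
  have hε' : 0 < 1 - ε := by linarith
  obtain ⟨lam, hlam, hlam'⟩ := exists_rpow_eq hm
    (by positivity : 0 < kernelCoeff α m * (1 - ε) ^ 3 * B)
  refine ⟨ε, lam, hε0, hε1, hlam, ?_, ?_⟩
  · rw [hlam']
    have : (1 - ε) ^ 3 < (1 - ε) ^ 2 := by nlinarith [pow_pos hε' 2]
    gcongr
  · rw [hlam', constA]
    have := mul_le_mul_of_nonneg_left hε.le (by positivity : 0 ≤ W / (m + 1))
    calc _ = W / (m + 1) * (kernelUpperCoeff α m ε / (kernelCoeff α m * (1 - ε) ^ 3 * B)) := by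
          field_simp
      _ ≤ _ := this
      _ = _ := by field_simp

/-! ### Recurrence for the error. -/

/-- Convexity of the power nonlinearity. -/
lemma convex_error_le {m a b : ℝ} (hm : 0 < m) (ha : 0 < a) (hb : 0 ≤ b)
    (h : a ^ (m + 1) ≤ b ^ (m + 1)) :
    a ≤ b ∧ (m + 1) * a ^ m * (b - a) ≤ b ^ (m + 1) - a ^ (m + 1) := by
  refine ⟨(Real.rpow_le_rpow_iff ha.le hb (by linarith)).1 h, ?_⟩
  have hs : (-1 : ℝ) ≤ b / a - 1 := by linarith [div_nonneg hb ha.le]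
  have hB := one_add_mul_self_le_rpow_one_add hs (by linarith : 1 ≤ m + 1)
  rw [add_sub_cancel, Real.div_rpow hb ha.le, le_div_iff₀ (by positivity)] at hB
  have e : (1 + (m + 1) * (b / a - 1)) * a ^ (m + 1) =
      a ^ (m + 1) + (m + 1) * a ^ m * (b - a) := by
    rw [Real.rpow_add ha, Real.rpow_one]
    field_simp
  linarith

/-- Division of the linearised error inequality by the lower power estimate. -/
lemma error_le_of_linearised {m p β W U lam x h S δ v e : ℝ} (hm : 0 < m) (hβ : β * m = p + 1)
    (hlam : 0 < lam) (hx : 0 < x) (he : 0 ≤ e) (hv : lam * x ^ β ≤ v)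
    (hle : (m + 1) * v ^ m * e ≤ h * (W * (U * x ^ p) * S) + δ) :
    e ≤ W * U / ((m + 1) * lam ^ m) * (h / x) * S + 1 / ((m + 1) * lam ^ m) * δ * x ^ (-(p + 1)) := by
  have h1 : lam ^ m * x ^ (p + 1) ≤ v ^ m := by
    calc lam ^ m * x ^ (p + 1) = (lam * x ^ β) ^ m := by
          rw [Real.mul_rpow hlam.le (by positivity), ← Real.rpow_mul hx.le, hβ]
      _ ≤ v ^ m := Real.rpow_le_rpow (by positivity) hv hm.le
  have h2 : (m + 1) * (lam ^ m * x ^ (p + 1)) * e ≤ h * (W * (U * x ^ p) * S) + δ :=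
    le_trans (by gcongr) hle
  have hd : 0 < (m + 1) * (lam ^ m * x ^ (p + 1)) := by positivity
  have h3 : e ≤ (h * (W * (U * x ^ p) * S) + δ) / ((m + 1) * (lam ^ m * x ^ (p + 1))) := by
    rw [le_div_iff₀ hd]; linarith
  refine h3.trans_eq ?_
  rw [Real.rpow_neg hx.le, Real.rpow_add hx, Real.rpow_one]
  field_simp

lemma grid_eq_mul_mesh (N n : ℕ) : grid N n = n * mesh N := by
  rw [grid, mesh, mul_one_div]

lemma mesh_pos {N : ℕ} (hN : 1 ≤ N) : 0 < mesh N := by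
  have : (0 : ℝ) < N := by exact_mod_cast hN
  unfold mesh
  positivity

lemma grid_pos {N n : ℕ} (hN : 1 ≤ N) (hn : 1 ≤ n) : 0 < grid N n := by
  have : (0 : ℝ) < n := by exact_mod_cast hn
  rw [grid_eq_mul_mesh]
  exact mul_pos this (mesh_pos hN)

lemma grid_nonneg (N n : ℕ) : 0 ≤ grid N n := by
  unfold grid
  positivity

lemma grid_mono (N : ℕ) {i n : ℕ} (h : i ≤ n) : grid N i ≤ grid N n := by
  unfold grid
  gcongr

lemma le_of_grid_le_one {N n : ℕ} (hN : 1 ≤ N) (h : grid N n ≤ 1) : n ≤ N := by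
  have : (0 : ℝ) < N := by exact_mod_cast hN
  rw [grid, div_le_one this] at h
  exact_mod_cast h

lemma abs_localError_le {α m : ℝ} {y : ℝ → ℝ} {N : ℕ} (hN : 1 ≤ N) {w : ℕ → ℕ → ℝ} {n : ℕ}
    (hn : 1 ≤ n) (hnN : n ≤ N) : |localError α m y N w n| ≤ maxError α m y N hN w :=
  Finset.le_sup' (fun n => |localError α m y N w n|) (Finset.mem_Icc.2 ⟨hn, hnN⟩)

lemma quadrature_sub (α m : ℝ) (N : ℕ) (w : ℕ → ℕ → ℝ) (v v' : ℕ → ℝ) (n : ℕ) :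
    quadrature α m N w v n - quadrature α m N w v' n =
      quadrature α m N w (fun i => v i - v' i) n := by
  simp only [quadrature]
  rw [← mul_sub, ← Finset.sum_sub_distrib]
  congr 1
  exact Finset.sum_congr rfl fun i _ => by ring

/-- The error of the scheme is nonnegative and satisfies the linearised recurrence. -/
lemma scheme_error {α m X W : ℝ} (hα0 : 0 < α) (hα1 : α < 1) (hm : 0 < m) (hX1 : X < 1)
    {y : ℝ → ℝ} (hy : IsNontrivialSolution α m y) {N : ℕ} (hN : 1 ≤ N) {w : ℕ → ℕ → ℝ} {Y : ℕ → ℝ}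
    (hw : ∀ n i : ℕ, 1 ≤ i → i < n → grid N n ≤ X → 0 < w n i ∧ w n i ≤ W)
    (hloc : ∀ n : ℕ, 2 ≤ n → grid N n ≤ X → localError α m y N w n ≤ 0)
    (hY : IsScheme α m X N w Y) (hY1 : y (mesh N) ≤ Y 1) {n : ℕ} (hn : 1 ≤ n)
    (hnX : grid N n ≤ X) :
    0 ≤ Y n - y (grid N n) ∧ (2 ≤ n → (m + 1) * y (grid N n) ^ m * (Y n - y (grid N n)) ≤
      quadrature α m N w (fun i => Y i - y (grid N i)) n + maxError α m y N hN w) := by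
  induction n using Nat.strong_induction_on with
  | _ n ih =>
  rcases hn.eq_or_lt with rfl | hn2
  · refine ⟨?_, by omega⟩
    rw [grid_eq_mul_mesh, Nat.cast_one, one_mul]
    linarith
  · have hz : grid N n ∈ Ioc (0 : ℝ) 1 := ⟨grid_pos hN hn, by linarith⟩
    have hq : 0 ≤ quadrature α m N w (fun i => Y i - y (grid N i)) n := by
      refine mul_nonneg (mesh_pos hN).le (Finset.sum_nonneg fun i hi => ?_)
      rw [Finset.mem_Ico] at hi
      refine mul_nonneg (mul_nonneg (hw n i hi.1 hi.2 hnX).1.le ?_)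
        (ih i hi.2 hi.1 ((grid_mono N hi.2.le).trans hnX)).1
      exact kernel_nonneg hα0 hα1 hm (grid_nonneg N i) (grid_mono N hi.2.le) (by linarith)
    have hstep := hY.step n hn2 hnX
    have heq := hy.eq _ (Ioc_subset_Icc_self hz)
    have hsub := quadrature_sub α m N w Y (fun i => y (grid N i)) n
    have hl := hloc n hn2 hnX
    have hab := abs_localError_le (α := α) (m := m) (y := y) hN (w := w) hn
      (le_of_grid_le_one hN hz.2)
    have hab' := neg_abs_le (localError α m y N w n)
    have hdef : localError α m y N w n = y (grid N n) ^ (m + 1) -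
        quadrature α m N w (fun i => y (grid N i)) n := by rw [localError, heq]
    -- Y_n^(m+1) - y(z_n)^(m+1) is the quadrature of the errors minus δ_n; the former is nonnegative
    -- by induction, and δ_n ≤ 0.
    obtain ⟨h1, h2⟩ := convex_error_le hm (hy.pos _ hz) (hY.nonneg n hn hnX) (by linarith)
    exact ⟨by linarith, fun _ => by linarith⟩

/-- Enlarging z_n - z_i to z_n leaves the power z_n^(1-α), which divided by z_n^(2-α) gives the
Cesàro factor h/z_n = 1/n. -/
lemma quadrature_le {α m X W Z : ℝ} (hα0 : 0 < α) (hα1 : α < 1) (hm : 0 < m) (hW : 0 < W)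
    (hZ0 : 0 ≤ Z) (hZ : Z < 1) {N : ℕ} (hN : 1 ≤ N) {w : ℕ → ℕ → ℝ} {e : ℕ → ℝ} {n : ℕ}
    (hw : ∀ n i : ℕ, 1 ≤ i → i < n → grid N n ≤ X → 0 < w n i ∧ w n i ≤ W)
    (hnX : grid N n ≤ X) (hnZ : grid N n ≤ Z) (he : ∀ i, 1 ≤ i → i < n → 0 ≤ e i) :
    quadrature α m N w e n ≤ mesh N * (W * (kernelUpperCoeff α m Z * grid N n ^ (1 - α)) *
      ∑ i ∈ Finset.Ico 1 n, e i) := by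
  unfold quadrature
  refine mul_le_mul_of_nonneg_left ?_ (mesh_pos hN).le
  rw [Finset.mul_sum]
  refine Finset.sum_le_sum fun i hi => ?_
  rw [Finset.mem_Ico] at hi
  have hg := grid_mono N hi.2.le
  have hg0 := grid_nonneg N i
  have hU := (kernelUpperCoeff_pos hα0 hα1 hm hZ0 hZ).le
  have hk : kernel α m (grid N n) (grid N i) ≤ kernelUpperCoeff α m Z * grid N n ^ (1 - α) :=
    (kernel_upper hα0 hα1 hm hg0 hg hnZ hZ).trans (mul_le_mul_of_nonneg_left
      (Real.rpow_le_rpow (by linarith) (by linarith) (by linarith)) hU)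
  have hk0 := kernel_nonneg hα0 hα1 hm hg0 hg (by linarith)
  exact mul_le_mul_of_nonneg_right (mul_le_mul (hw n i hi.1 hi.2 hnX).2 hk hk0 hW.le)
    (he i hi.1 hi.2)

end PorousVolterra

end

/-! ### Assembly of the estimate. -/

theorem theorem1 (α m X W C₁ : ℝ) (hα0 : 0 < α) (hα1 : α < 1) (hm : 1 < m)
    (hX0 : 0 < X) (hX1 : X < 1) (hW : 0 < W)
    (hC0 : 0 < C₁) (hC1 : C₁ ≤ PorousVolterra.lowerConst α m) :
    ∀ z₀ : ℝ, 0 < z₀ → ∃ C : ℝ, 0 < C ∧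
      ∀ (y : ℝ → ℝ), PorousVolterra.IsNontrivialSolution α m y →
      ∀ (N : ℕ) (hN : 1 ≤ N) (w : ℕ → ℕ → ℝ) (Y : ℕ → ℝ),
        (∀ n i : ℕ, 1 ≤ i → i < n → PorousVolterra.grid N n ≤ X → 0 < w n i ∧ w n i ≤ W) →
        (∀ n : ℕ, 2 ≤ n → PorousVolterra.grid N n ≤ X →
          PorousVolterra.localError α m y N w n ≤ 0) →
        PorousVolterra.IsScheme α m X N w Y →
        y (PorousVolterra.mesh N) ≤ Y 1 →
        |Y 1 - y (PorousVolterra.mesh N)| ≤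
          1 / ((m + 1) * C₁ ^ m) *
            (PorousVolterra.maxError α m y N hN w / PorousVolterra.mesh N ^ (2 - α)) →
        ∀ n : ℕ, z₀ ≤ PorousVolterra.grid N n → PorousVolterra.grid N n ≤ X →
          |Y n - y (PorousVolterra.grid N n)| ≤
            C * PorousVolterra.maxError α m y N hN w *
              PorousVolterra.mesh N ^ (α - PorousVolterra.constA α m X W C₁ - 1) := by
  open PorousVolterra in
  intro z₀ hz₀
  have hm0 : 0 < m := by linarith
  have hβ0 : 0 < (2 - α) / m := rpow_exponent_pos hα1 hm0
  have hβm : (2 - α) / m * m = 2 - α := div_mul_cancel₀ _ hm0.ne'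
  have hβm' : (2 - α) / m * m = (1 - α) + 1 := by rw [hβm]; ring
  have hB : 0 < ProbabilityTheory.beta ((2 - α) / m + 1) (2 - α) :=
    ProbabilityTheory.beta_pos (by linarith) (by linarith)
  have hD0 := kernelCoeff_pos hα0 hα1 hm0
  obtain ⟨ε, lam, hε0, hε1, hlam, hlam', hA⟩ :=
    exists_local_constants hα0 hα1 hm0 hX0 hX1 hW hC0 hC1
  have hX : 0 < 1 - X := by linarith
  -- A cruder lower constant valid on all of (0, X]; it affects C but not the exponent.
  obtain ⟨mu, hmu, hmu'⟩ := exists_rpow_eq hm0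
    (by positivity : 0 < kernelCoeff α m * (1 - X) ^ 3 *
      ProbabilityTheory.beta ((2 - α) / m + 1) (2 - α))
  have hmu'' : mu ^ m < kernelCoeff α m * (1 - X) ^ 2 *
      ProbabilityTheory.beta ((2 - α) / m + 1) (2 - α) := by
    rw [hmu']
    have : (1 - X) ^ 3 < (1 - X) ^ 2 := by nlinarith [pow_pos hX 2]
    gcongr
  have hUε := kernelUpperCoeff_pos hα0 hα1 hm0 hε0.le hε1
  have hUX := kernelUpperCoeff_pos hα0 hα1 hm0 hX0.le hX1
  have hA0 : 0 ≤ constA α m X W C₁ := le_trans (by positivity) hA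
  set A := constA α m X W C₁
  set M := W * kernelUpperCoeff α m X / ((m + 1) * mu ^ m) with hM
  have hM0 : 0 < M := by positivity
  -- One forcing constant for the starting error and the regimes z ≤ ε and z > ε.
  set cb := 1 / ((m + 1) * C₁ ^ m) + 1 / ((m + 1) * lam ^ m) + 1 / ((m + 1) * mu ^ m) with hcb
  have k1 : 0 < 1 / ((m + 1) * C₁ ^ m) := by positivity
  have k2 : 0 < 1 / ((m + 1) * lam ^ m) := by positivity
  have k3 : 0 < 1 / ((m + 1) * mu ^ m) := by positivity
  have hcb0 : 0 < cb := by positivity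
  obtain ⟨Q, hQ, hgron⟩ := gronwall_le hA0 (div_pos hM0 hε0).le (by linarith : 1 < 2 - α)
  refine ⟨Q * cb * (1 / z₀), by positivity, ?_⟩
  intro y hy N hN w Y hw hloc hY hY1 hY1' n hz₀n hnX
  have hn : 1 ≤ n := by
    by_contra! h
    obtain rfl : n = 0 := by omega
    simp [grid] at hz₀n
    linarith
  have hh := mesh_pos hN
  set h := mesh N with hhdef
  set δ := maxError α m y N hN w with hδ
  have hδ0 : 0 ≤ δ := (abs_nonneg _).trans (abs_localError_le (n := 1) hN le_rfl hN)
  set e : ℕ → ℝ := fun i => Y i - y (grid N i) with he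
  have he0 : ∀ k, 1 ≤ k → k ≤ n → 0 ≤ e k := fun k hk hkn =>
    (scheme_error hα0 hα1 hm0 hX1 hy hN hw hloc hY hY1 hk ((grid_mono N hkn).trans hnX)).1
  have hb0 : 0 ≤ cb * δ * h ^ (-(2 - α)) := by positivity
  have hgrid1 : grid N 1 = h := by rw [grid_eq_mul_mesh, Nat.cast_one, one_mul]
  have he1 : e 1 ≤ cb * δ * h ^ (-(2 - α)) := by
    have : e 1 ≤ 1 / ((m + 1) * C₁ ^ m) * (δ / h ^ (2 - α)) := by
      simp only [he, hgrid1]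
      exact (le_abs_self _).trans hY1'
    refine this.trans ?_
    rw [div_eq_mul_inv δ, ← Real.rpow_neg hh.le, ← mul_assoc]
    gcongr
    linarith
  have hrec : ∀ k : ℕ, 2 ≤ k → k ≤ n → e k ≤ (A / k + M / ε * h) * ∑ i ∈ Finset.Ico 1 k, e i +
      cb * δ * h ^ (-(2 - α)) * (k : ℝ) ^ (-(2 - α)) := by
    intro k hk hkn
    have hkX : grid N k ≤ X := (grid_mono N hkn).trans hnX
    have hk0 : (0 : ℝ) < k := by exact_mod_cast (by omega : 0 < k)
    have hx := grid_pos hN (by omega : 1 ≤ k)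
    have hlin := (scheme_error hα0 hα1 hm0 hX1 hy hN hw hloc hY hY1 (by omega) hkX).2 hk
    have hS : 0 ≤ ∑ i ∈ Finset.Ico 1 k, e i := Finset.sum_nonneg fun i hi => by
      rw [Finset.mem_Ico] at hi
      exact he0 i hi.1 (by omega)
    have hhx : h / grid N k = 1 / k := by
      rw [grid_eq_mul_mesh, ← hhdef]; field_simp
    have hxp : grid N k ^ (-((1 - α) + 1)) = h ^ (-(2 - α)) * (k : ℝ) ^ (-(2 - α)) := by
      rw [grid_eq_mul_mesh, ← hhdef, Real.mul_rpow hk0.le hh.le, mul_comm]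
      congr 2 <;> ring
    have main : ∀ Z c : ℝ, 0 < Z → Z < 1 → grid N k ≤ Z → 0 < c →
        c ^ m < kernelCoeff α m * (1 - Z) ^ 2 *
          ProbabilityTheory.beta ((2 - α) / m + 1) (2 - α) →
        e k ≤ W * kernelUpperCoeff α m Z / ((m + 1) * c ^ m) * (1 / k) *
          ∑ i ∈ Finset.Ico 1 k, e i +
          1 / ((m + 1) * c ^ m) * δ * (h ^ (-(2 - α)) * (k : ℝ) ^ (-(2 - α))) := by
      intro Z c hZ0 hZ1 hkZ hc hc'
      have hv : c * grid N k ^ ((2 - α) / m) ≤ y (grid N k) :=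
        hy.power_le hα1 hm0 (by have : 0 < 1 - Z := by linarith
                                positivity) hβ0 hβm hc hc' hZ1
          (fun z u hu huz hz => kernel_lower hα0 hα1 hm0 hu huz hz hZ1) hx hkZ
      have hq := quadrature_le hα0 hα1 hm0 hW hZ0.le hZ1 hN hw hkX hkZ
        (fun i hi hik => he0 i hi (by omega))
      have := error_le_of_linearised hm0 hβm' hc hx (he0 k (by omega) hkn) hv
        (hlin.trans (add_le_add_left hq _))
      rwa [hhx, hxp] at this
    have hrp : 0 ≤ h ^ (-(2 - α)) * (k : ℝ) ^ (-(2 - α)) := by positivity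
    have hMh : 0 ≤ M / ε * h := by positivity
    have hAk : 0 ≤ A / k := by positivity
    rw [mul_assoc (cb * δ)]
    rcases le_or_gt (grid N k) ε with hkε | hkε
    · refine (main ε lam hε0 hε1 hkε hlam hlam').trans ?_
      have : W * kernelUpperCoeff α m ε / ((m + 1) * lam ^ m) * (1 / k) ≤ A / k + M / ε * h := by
        have : W * kernelUpperCoeff α m ε / ((m + 1) * lam ^ m) * (1 / k) ≤ A * (1 / k) := by
          gcongr
        linarith [mul_one_div A (k : ℝ)]
      gcongr
      linarith
    · refine (main X mu hX0 hX1 hkX hmu hmu'').trans ?_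
      have : M * (1 / k) ≤ A / k + M / ε * h := by
        have : 1 / (k : ℝ) ≤ h / ε := by
          rw [← hhx]; gcongr
        have := mul_le_mul_of_nonneg_left this hM0.le
        have e2 : M * (h / ε) = M / ε * h := by ring
        linarith
      rw [← hM]
      gcongr
      linarith
  have hnh : (n : ℝ) * h ≤ 1 := by rw [hhdef, ← grid_eq_mul_mesh]; linarith
  have hfin := hgron h _ e n hh.le hb0 hnh he0 he1 hrec n hn le_rfl
  have hn0 : (0 : ℝ) < n := by exact_mod_cast hn
  have hx := grid_pos hN hn
  -- Whatever the sign of A-1, z_n^(A-1) = z_n^A / z_n ≤ 1/z₀, since z_n ≤ 1.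
  have hpow : (n : ℝ) ^ (A - 1) ≤ 1 / z₀ * h ^ (1 - A) := by
    have e1 : (n : ℝ) = grid N n / h := by rw [grid_eq_mul_mesh, ← hhdef]; field_simp
    rw [e1, Real.div_rpow hx.le hh.le, div_eq_mul_inv, ← Real.rpow_neg hh.le, neg_sub]
    gcongr
    rw [Real.rpow_sub hx, Real.rpow_one]
    have : grid N n ^ A ≤ 1 := Real.rpow_le_one hx.le (by linarith) hA0
    gcongr
  have hexp : h ^ (-(2 - α)) * h ^ (1 - A) = h ^ (α - A - 1) := by
    rw [← Real.rpow_add hh]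
    congr 1
    ring
  rw [abs_of_nonneg (he0 n hn le_rfl)]
  calc e n ≤ Q * (cb * δ * h ^ (-(2 - α))) * (n : ℝ) ^ (A - 1) := hfin
    _ ≤ Q * (cb * δ * h ^ (-(2 - α))) * (1 / z₀ * h ^ (1 - A)) := by gcongr
    _ = Q * cb * (1 / z₀) * δ * (h ^ (-(2 - α)) * h ^ (1 - A)) := by ring
    _ = _ := by rw [hexp]
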